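/- Let $T$ be (the vertex set of) a countable, locally finite tree with root $x_0$, and let $T_n$ be the set of vertices at distance $n$ from $x_0$. For $x\neq x_0$ let $x^-$ be the parent of $x$, i.e. its neighbour on the geodesic from $x_0$ to $x$, and for every vertex $x$ let $S(x)$ be the set of the neighbours of $x$ other than $x^-$; assume that $S(x)$ has at least two elements for every $x$. Let numbers $q(x,y)$ be given with $q(x,y)>0$ for $y\in S(x)$, $q(x,x^-)=0$ and $\sum_{y\in S(x)}q(x,y)=1$ for every $x$. Let $\partial T$ be the set of infinite geodesics $e=(y_n)_{n\ge0}$ with $y_0=x_0$ and $y_{n+1}\in S(y_n)$ for all $n$, let $\mathcal M$ be the $\sigma$-algebra on $\partial T$ generated by the sectors $B_x=\{e\in\partial T: x\in e\}$, $x\in T$, and let $\mathbb P$ be the unique probability measure on $\mathcal M$ with $\mathbb P(B_x)=\prod_{j=0}^{n-1}q(y_j,y_{j+1})$ whenever $x\in T_n$ and $x_0=y_0,y_1,\dots,y_n=x$ is the geodesic from $x_0$ to $x$. Let $E\neq\{0\}$ be a real or complex separable Fréchet space, with a complete translation-invariant metric $d$ that induces its topology. Let $H_Q(T,E)$ be the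 set of the harmonic functions $f:T\to E$, i.e. those with $f(x)=\sum_{y\in S(x)}q(x,y)f(y)$ for all $x\in T$, with the topology of pointwise convergence. Let $L^0(\partial T,E)$ be the space of $\mathcal M$-measurable functions $\partial T\to E$ modulo $\mathbb P$-almost everywhere equality, with the metric of convergence in probability $$\tilde\rho(h_1,h_2)=\int_{\partial T}\frac{d(h_1,h_2)}{1+d(h_1,h_2)}\,d\mathbb P .$$ For $f\in H_Q(T,E)$ and $n\ge0$ let $\omega_n(f):\partial T\to E$ be given by $\omega_n(f)(e)=f(y_n)$, where $y_n$ is the element of $e\cap T_n$. Call $f\in H_Q(T,E)$ frequently universal if for every non-empty open set $V\subseteq L^0(\partial T,E)$ the set $A=\{n\in\mathbb N:\omega_n(f)\in V\}$ has strictly positive lower density, i.e. $\liminf_{n\to\infty}\frac{1}{n+1}\,\mathrm{card}\{m\in A:m\le n\}>0$. Let $U_{FM}(T,E)$ be the set of frequently universal functions in $H_Q(T,E)$. **Theorem.** The set $U_{FM}(T,E)$ is non-empty, and it is dense and meager in $H_Q(T,E)$ (meager: contained in a countable union of closed subsets of $H_Q(T,E)$ with empty interior). -/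

import Mathlib

open MeasureTheory Filter Topology

noncomputable section

namespace HarmonicTree

variable {T : Type*}

/-- `z` is the parent `x⁻` of `x`: the neighbour of `x` on the geodesic from `x₀` to `x`. -/
def IsParent (G : SimpleGraph T) (x₀ z x : T) : Prop :=
  G.Adj z x ∧ G.dist x₀ z + G.dist z x = G.dist x₀ x

/-- `S(x)`: the neighbours of `x` other than its parent. -/
def successorSet (G : SimpleGraph T) (x₀ x : T) : Set T :=
  {y | G.Adj x y ∧ ¬ IsParent G x₀ y x}

/-- The parent is unique. -/
lemma IsParent.unique {G : SimpleGraph T} (hG : G.IsTree) {x₀ u v w : T}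
    (hu : IsParent G x₀ u w) (hv : IsParent G x₀ v w) : u = v := by
  classical
  obtain ⟨p, hp, -⟩ := hG.connected.exists_path_of_dist x₀ w
  have key : ∀ z, IsParent G x₀ z w → z = p.penultimate := by
    rintro z ⟨hadj, hz⟩
    obtain ⟨r, hr, hrl⟩ := hG.connected.exists_path_of_dist x₀ z
    rw [SimpleGraph.dist_eq_one_iff_adj.2 hadj] at hz
    refine hG.isAcyclic.eq_penultimate_of_adj_end hp hadj.symm
      (hG.isAcyclic.mem_support_of_ne_mem_support_of_adj_of_isPath hp hr hadj.symm fun hw => ?_)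
    have h1 := SimpleGraph.dist_le (r.takeUntil w hw)
    have h2 := r.length_takeUntil_le_length hw
    omega
  rw [key u hu, key v hv]

end HarmonicTree

open HarmonicTree

/-- A rooted, locally finite tree with vertex set `T`, in which every vertex has at least two
successors, together with the transition numbers `q(x,y)`. -/
structure WeightedTree (T : Type*) where
  graph : SimpleGraph T
  isTree : graph.IsTree
  finite_neighborSet : ∀ x, (graph.neighborSet x).Finite
  root : T
  two_le_successors : ∀ x, 2 ≤ (successorSet graph root x).ncard
  q : T → T → ℝ
  q_pos : ∀ x, ∀ y ∈ successorSet graph root x, 0 < q x y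
  q_parent : ∀ x z, IsParent graph root z x → q x z = 0
  sum_q : ∀ x, ∑ᶠ y ∈ successorSet graph root x, q x y = 1

namespace WeightedTree

variable {T : Type*} (M : WeightedTree T)

lemma finite_successorSet (x : T) : (successorSet M.graph M.root x).Finite :=
  (M.finite_neighborSet x).subset fun _ hy => hy.1

/-- `S(x)` as a finite set. -/
def S (x : T) : Finset T := (M.finite_successorSet x).toFinset

@[simp] lemma mem_S {x y : T} :
    y ∈ M.S x ↔ M.graph.Adj x y ∧ ¬ IsParent M.graph M.root y x := by
  simp [S, successorSet]

lemma q_pos_of_mem {x y : T} (h : y ∈ M.S x) : 0 < M.q x y :=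
  M.q_pos x y (by simpa [S] using h)

lemma sum_S (x : T) : ∑ y ∈ M.S x, M.q x y = 1 := by
  rw [← M.sum_q x, finsum_mem_eq_finite_toFinset_sum _ (M.finite_successorSet x)]
  rfl

lemma dist_of_mem_S {x y : T} (h : y ∈ M.S x) :
    M.graph.dist M.root y = M.graph.dist M.root x + 1 := by
  obtain ⟨hadj, hp⟩ := M.mem_S.1 h
  have hxy : M.graph.dist x y = 1 := SimpleGraph.dist_eq_one_iff_adj.2 hadj
  have hyx : M.graph.dist y x = 1 := SimpleGraph.dist_eq_one_iff_adj.2 hadj.symm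
  have h1 := M.isTree.connected.dist_triangle (u := M.root) (v := x) (w := y)
  have h2 := M.isTree.connected.dist_triangle (u := M.root) (v := y) (w := x)
  have h3 := M.isTree.dist_ne_of_adj M.root hadj
  have h4 : ¬ (M.graph.dist M.root y + M.graph.dist y x = M.graph.dist M.root x) :=
    fun h => hp ⟨hadj.symm, h⟩
  omega

lemma isParent_of_mem_S {x y : T} (h : y ∈ M.S x) : IsParent M.graph M.root x y := by
  have hadj := (M.mem_S.1 h).1
  exact ⟨hadj, by rw [SimpleGraph.dist_eq_one_iff_adj.2 hadj, M.dist_of_mem_S h]⟩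

/-- The boundary `∂T`: infinite geodesics starting at the root. -/
def Boundary : Type _ :=
  {e : ℕ → T // e 0 = M.root ∧ ∀ n, e (n + 1) ∈ M.S (e n)}

variable {M} in
/-- The vertex of the geodesic `e` at level `n`. -/
def Boundary.vertex (e : M.Boundary) (n : ℕ) : T := e.1 n

lemma dist_vertex (e : M.Boundary) (n : ℕ) : M.graph.dist M.root (e.vertex n) = n := by
  induction n with
  | zero => simp [Boundary.vertex, e.2.1]
  | succ n ih =>
    have h := M.dist_of_mem_S (e.2.2 n)
    simp only [Boundary.vertex] at ih ⊢
    omega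

/-- The boundary sector `B_x`. -/
def sector (x : T) : Set M.Boundary := {e | ∃ n, e.vertex n = x}

/-- The σ-algebra `𝓜` generated by the boundary sectors. -/
instance : MeasurableSpace M.Boundary := MeasurableSpace.generateFrom (Set.range M.sector)

lemma measurableSet_vertex_eq (n : ℕ) (x : T) :
    MeasurableSet {e : M.Boundary | e.vertex n = x} := by
  by_cases h : M.graph.dist M.root x = n
  · have : {e : M.Boundary | e.vertex n = x} = M.sector x := by
      ext e
      constructor
      · exact fun he => ⟨n, he⟩
      · rintro ⟨m, hm⟩
        have := M.dist_vertex e m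
        rw [hm, h] at this
        exact this ▸ hm
    rw [this]
    exact MeasurableSpace.measurableSet_generateFrom ⟨x, rfl⟩
  · convert MeasurableSet.empty
    ext e
    simp only [Set.mem_ofPred_eq, Set.mem_empty_iff_false, iff_false]
    rintro rfl
    exact h (M.dist_vertex e n)

/-- A successor of `x`, i.e. a possible step of the walk from `x`. -/
def Step (x : T) : Type _ := {y // y ∈ M.S x}

instance (x : T) : Fintype (M.Step x) := inferInstanceAs (Fintype {y // y ∈ M.S x})
instance (x : T) : MeasurableSpace (M.Step x) := ⊤

/-- The law of one step from `x`: the successor `y` is chosen with probability `q(x,y)`. -/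
def stepMeasure (x : T) : Measure (M.Step x) :=
  ∑ y : M.Step x, ENNReal.ofReal (M.q x y.1) • Measure.dirac y

lemma stepMeasure_singleton {x : T} (y : M.Step x) :
    M.stepMeasure x {y} = ENNReal.ofReal (M.q x y.1) := by
  classical
  simp only [stepMeasure, Measure.coe_finsetSum, Finset.sum_apply, Measure.smul_apply,
    smul_eq_mul]
  rw [Finset.sum_eq_single y]
  · simp
  · intro z _ hz
    simp [hz]
  · simp

instance (x : T) : IsProbabilityMeasure (M.stepMeasure x) := by
  constructor
  have h : ∑ y : M.Step x, M.q x y.1 = 1 := by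
    rw [← M.sum_S x]
    exact Finset.sum_coe_sort (M.S x) (M.q x)
  simp only [stepMeasure, Measure.coe_finsetSum, Finset.sum_apply, Measure.smul_apply,
    smul_eq_mul, measure_univ, mul_one]
  rw [← ENNReal.ofReal_sum_of_nonneg (fun y _ => (M.q_pos_of_mem y.2).le), h, ENNReal.ofReal_one]

/-- The path from the root which leaves each vertex `x` along the step `s x`. -/
def pathAux (s : ∀ x, M.Step x) : ℕ → T
  | 0 => M.root
  | n + 1 => (s (pathAux s n)).1

/-- The same path, as a boundary point. -/
def path (s : ∀ x, M.Step x) : M.Boundary :=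
  ⟨M.pathAux s, rfl, fun n => (s (M.pathAux s n)).2⟩

lemma measurableSet_pathAux [Countable T] (n : ℕ) (x : T) :
    MeasurableSet {s | M.pathAux s n = x} := by
  induction n generalizing x with
  | zero => exact MeasurableSet.const (M.root = x)
  | succ n ih =>
    have : {s | M.pathAux s (n + 1) = x} =
        ⋃ y, {s | M.pathAux s n = y} ∩ (fun s => s y) ⁻¹' {z : M.Step y | z.1 = x} := by
      ext s
      simp [pathAux]
    rw [this]
    exact MeasurableSet.iUnion fun y =>
      (ih y).inter (measurable_pi_apply y (MeasurableSpace.measurableSet_top))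

lemma measurable_path [Countable T] : Measurable M.path := by
  refine measurable_generateFrom ?_
  rintro _ ⟨x, rfl⟩
  have : M.path ⁻¹' M.sector x = ⋃ n, {s | M.pathAux s n = x} := by
    ext s
    simp [sector, path, Boundary.vertex]
  rw [this]
  exact MeasurableSet.iUnion fun n => M.measurableSet_pathAux n x

/-- The probability measure `P` on `(∂T, 𝓜)`: the law of the path which leaves each vertex by an
independent random step. It is the measure that gives each sector `B_x` the probability
`p(B_x)`, see `boundaryMeasure_sector`. -/
def boundaryMeasure : Measure M.Boundary :=
  (Measure.infinitePi M.stepMeasure).map M.path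

instance [Countable T] : IsProbabilityMeasure M.boundaryMeasure :=
  Measure.isProbabilityMeasure_map M.measurable_path.aemeasurable

/-- `P(B_x) = ∏_{j<n} q(y_j, y_{j+1})` for `x = y_n ∈ T_n` with geodesic `y_0, …, y_n`; every
vertex lies on some boundary point `e`. -/
theorem boundaryMeasure_sector [Countable T] (e : M.Boundary) (n : ℕ) :
    M.boundaryMeasure (M.sector (e.vertex n)) =
      ENNReal.ofReal (∏ j ∈ Finset.range n, M.q (e.vertex j) (e.vertex (j + 1))) := by
  classical
  have hinj : Function.Injective e.vertex := fun i j h => by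
    rw [← M.dist_vertex e i, h, M.dist_vertex]
  rw [boundaryMeasure, Measure.map_apply M.measurable_path
    (MeasurableSpace.measurableSet_generateFrom ⟨_, rfl⟩)]
  have hset : M.path ⁻¹' M.sector (e.vertex n) =
      Set.pi ((Finset.range n).image e.vertex : Finset T)
        (fun x => {z : M.Step x | ∀ j, e.vertex j = x → z.1 = e.vertex (j + 1)}) := by
    ext s
    have h1 : s ∈ M.path ⁻¹' M.sector (e.vertex n) ↔ M.pathAux s n = e.vertex n := by
      constructor
      · rintro ⟨m, hm⟩
        have := M.dist_vertex (M.path s) m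
        rw [hm, M.dist_vertex] at this
        exact this ▸ hm
      · exact fun h => ⟨n, h⟩
    have h2 : s ∈ Set.pi ((Finset.range n).image e.vertex : Finset T)
        (fun x => {z : M.Step x | ∀ j, e.vertex j = x → z.1 = e.vertex (j + 1)}) ↔
        ∀ j < n, (s (e.vertex j)).1 = e.vertex (j + 1) := by
      simp only [Set.mem_pi, Finset.mem_coe, Finset.mem_image, Finset.mem_range,
        Set.mem_ofPred_eq]
      constructor
      · exact fun h j hj => h _ ⟨j, hj, rfl⟩ j rfl
      · rintro h _ ⟨i, hi, rfl⟩ j hj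
        obtain rfl := hinj hj
        exact h _ hi
    rw [h1, h2]
    clear h1 h2
    induction n with
    | zero => simp [pathAux, Boundary.vertex, e.2.1]
    | succ n ih =>
      constructor
      · intro h
        have hp : M.pathAux s n = e.vertex n := by
          refine IsParent.unique M.isTree (x₀ := M.root) (w := e.vertex (n + 1)) ?_
            (M.isParent_of_mem_S (e.2.2 n))
          exact h ▸ M.isParent_of_mem_S ((M.path s).2.2 n)
        intro j hj
        rcases Nat.lt_succ_iff_lt_or_eq.1 hj with hj | rfl
        · exact ih.1 hp j hj
        · rw [← hp]
          exact h
      · intro h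
        have hp := ih.2 fun j hj => h j (by omega)
        rw [pathAux, hp]
        exact h n (by omega)
  rw [hset, Measure.infinitePi_pi, Finset.prod_image (fun _ _ _ _ h => hinj h),
    ENNReal.ofReal_prod_of_nonneg
      (fun j _ => (M.q_pos_of_mem (x := e.vertex j) (y := e.vertex (j + 1)) (e.2.2 j)).le)]
  · refine Finset.prod_congr rfl fun j _ => ?_
    refine Eq.trans ?_ (M.stepMeasure_singleton (x := e.vertex j) ⟨e.vertex (j + 1), e.2.2 j⟩)
    congr 1
    ext z
    simp only [Set.mem_ofPred_eq]
    constructor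
    · exact fun h => Subtype.ext (h j rfl)
    · rintro rfl i hi
      rw [hinj hi]
  · intro _ _
    exact MeasurableSpace.measurableSet_top

variable (E : Type*)

/-- `L⁰(∂T, E)`: classes of measurable functions `∂T → E` modulo `P`-a.e. equality. For separable
metric `E` these are represented exactly by the `𝓜`-measurable functions. -/
abbrev L0 [TopologicalSpace E] : Type _ := M.Boundary →ₘ[M.boundaryMeasure] E

section metric

variable {E} [MetricSpace E] [Countable T]

lemma integrable_L0 (f g : M.L0 E) :
    Integrable (fun e => dist (f e) (g e) / (1 + dist (f e) (g e))) M.boundaryMeasure := by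
  have hd := f.aestronglyMeasurable.dist g.aestronglyMeasurable
  refine Integrable.of_bound (C := 1)
    (hd.aemeasurable.div (hd.aemeasurable.const_add 1)).aestronglyMeasurable
    (Eventually.of_forall fun e => ?_)
  have h0 : 0 ≤ dist (f e) (g e) := dist_nonneg
  rw [Real.norm_of_nonneg (by positivity), div_le_one (by positivity)]
  linarith

/-- The distance `∫ d(f,g) / (1 + d(f,g)) dP`, which induces convergence in probability. -/
instance : MetricSpace (M.L0 E) where
  dist f g := ∫ e, dist (f e) (g e) / (1 + dist (f e) (g e)) ∂M.boundaryMeasure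
  dist_self f := by simp
  dist_comm f g := by simp only [dist_comm]
  dist_triangle f g h := by
    rw [← integral_add (M.integrable_L0 f g) (M.integrable_L0 g h)]
    refine integral_mono (M.integrable_L0 f h)
      ((M.integrable_L0 f g).add (M.integrable_L0 g h)) fun e => ?_
    have ht := dist_triangle (f e) (g e) (h e)
    have h1 : 0 ≤ dist (f e) (g e) := dist_nonneg
    have h2 : 0 ≤ dist (g e) (h e) := dist_nonneg
    have h3 : 0 ≤ dist (f e) (h e) := dist_nonneg
    generalize dist (f e) (g e) = a at *
    generalize dist (g e) (h e) = b at *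
    generalize dist (f e) (h e) = c at *
    calc c / (1 + c) ≤ (a + b) / (1 + (a + b)) := by
          rw [div_le_div_iff₀ (by positivity) (by positivity)]; nlinarith
      _ = a / (1 + (a + b)) + b / (1 + (a + b)) := add_div _ _ _
      _ ≤ a / (1 + a) + b / (1 + b) := by gcongr <;> linarith
  eq_of_dist_eq_zero {f g} h := by
    rw [integral_eq_zero_iff_of_nonneg _ (M.integrable_L0 f g)] at h
    · refine AEEqFun.ext ?_
      filter_upwards [h] with e he
      have h0 : 0 ≤ dist (f e) (g e) := dist_nonneg
      have : dist (f e) (g e) = 0 := by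
        rcases div_eq_zero_iff.1 he with h' | h'
        · exact h'
        · linarith
      exact dist_eq_zero.1 this
    · intro e
      have h0 : 0 ≤ dist (f e) (g e) := dist_nonneg
      simp only [Pi.zero_apply]
      positivity

lemma L0_dist_def (f g : M.L0 E) :
    dist f g = ∫ e, dist (f e) (g e) / (1 + dist (f e) (g e)) ∂M.boundaryMeasure := rfl

end metric

/-- `H_Q(T, E)`, the harmonic functions `f : T → E`; as a subset of `T → E` it carries the topology
of pointwise convergence. -/
def HQ (𝕜 : Type*) [RCLike 𝕜] [AddCommGroup E] [Module 𝕜 E] : Set (T → E) :=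
  {f | ∀ x, f x = ∑ y ∈ M.S x, ((M.q x y : ℝ) : 𝕜) • f y}

variable {E}

lemma aestronglyMeasurable_omega [Countable T] [TopologicalSpace E] (n : ℕ) (f : T → E) :
    AEStronglyMeasurable (fun e : M.Boundary => f (e.vertex n)) M.boundaryMeasure := by
  let : MeasurableSpace T := ⊤
  have : DiscreteMeasurableSpace T := ⟨fun _ => MeasurableSpace.measurableSet_top⟩
  have hm : Measurable fun e : M.Boundary => e.vertex n :=
    measurable_to_countable' fun x => M.measurableSet_vertex_eq n x
  exact ((StronglyMeasurable.of_discrete (f := f)).comp_measurable hm).aestronglyMeasurable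

/-- `ω_n(f)`, the class of `e ↦ f(y_n)` with `y_n` the vertex of `e` at level `n`. -/
def omega [Countable T] [TopologicalSpace E] (n : ℕ) (f : T → E) : M.L0 E :=
  AEEqFun.mk (fun e => f (e.vertex n)) (M.aestronglyMeasurable_omega n f)

/-- The lower density `liminf_n (1/(n+1)) · card {m ∈ A : m ≤ n}` of a set of naturals. -/
def _root_.lowerDensity (A : Set ℕ) : ℝ :=
  liminf (fun n : ℕ => 1 / ((n : ℝ) + 1) * ({m ∈ A | m ≤ n}.ncard : ℝ)) atTop

variable (E) in
/-- `U_FM(T, E)`: the frequently universal harmonic functions, as a subset of `H_Q(T, E)`. -/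
def UFM (𝕜 : Type*) [RCLike 𝕜] [Countable T] [MetricSpace E] [AddCommGroup E] [Module 𝕜 E] :
    Set (M.HQ E 𝕜) :=
  {f | ∀ V : Set (M.L0 E), IsOpen V → V.Nonempty → 0 < lowerDensity {n | M.omega n f.1 ∈ V}}

end WeightedTree

end

/-! At each vertex single out a successor of least probability, the rare one; it is chosen with
probability at most 1/2. Harmonicity forces only the value at the rare successor, so beyond any
level all other values are free (`exists_harmonic_extension`). If the free values on `k` consecutive
levels copy a function `h` that is constant along descendants, then one non-rare step in the block
makes `f` equal to `h`, and harmonicity keeps it so to the end of the block. Hence `ω_{n+k}(f)` is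
within `2⁻ᵏ` of `h` (`dist_omega_le_of_eq_on_block`).

By martingale convergence, functions of one vertex with values in a countable dense set give
countably many targets dense in `L⁰` (`exists_dist_omega_lt`). Spreading targets and precisions over
blocks of positive lower density (`exists_block_labelling`) gives a frequently universal function,
with prescribed values up to any level; this yields existence and density.

For meagerness, copying a constant `b` gives a dense set of `f` with `ω_n(f) → b`. So generically
`ω_n(f)` visits a ball about another constant `a` with lower density zero. -/

/-! ### Lower density and blocks of integers. -/

lemma lowerDensity_pos_of_strictMono {A : Set ℕ} {g : ℕ → ℕ} {C : ℕ} (hg : StrictMono g)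
    (hA : ∀ i, g i ∈ A) (hC : ∀ i, g i ≤ C * (i + 1)) : 0 < lowerDensity A := by
  have hfin : ∀ n, {m ∈ A | m ≤ n}.Finite := fun n => (Set.finite_Iic n).subset fun m hm => hm.2
  have hcard : ∀ n, n / (C + 1) ≤ {m ∈ A | m ≤ n}.ncard := by
    intro n
    have h := Set.ncard_le_ncard (s := g '' (Finset.range (n / (C + 1)) : Set ℕ)) ?_ (hfin n)
    · rwa [Set.ncard_image_of_injective _ hg.injective, Set.ncard_coe_finset,
        Finset.card_range] at h
    · rintro _ ⟨i, hi, rfl⟩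
      refine ⟨hA i, (hC i).trans ?_⟩
      have hi' : i + 1 ≤ n / (C + 1) := by simpa using hi
      calc C * (i + 1) ≤ (C + 1) * (n / (C + 1)) := by gcongr; omega
        _ ≤ n := Nat.mul_div_le n (C + 1)
  have hle : ∀ n, {m ∈ A | m ≤ n}.ncard ≤ n + 1 := by
    intro n
    have h := Set.ncard_le_ncard (s := {m ∈ A | m ≤ n}) (t := (Finset.range (n + 1) : Set ℕ))
      (fun m hm => by simpa using Nat.lt_succ_of_le hm.2) (Finset.finite_toSet _)
    rwa [Set.ncard_coe_finset, Finset.card_range] at h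
  -- The factor 2 absorbs the rounding in `n / (C + 1)` once `n ≥ 2 * C + 1`.
  have hpos : (0 : ℝ) < 1 / (2 * ((C : ℝ) + 1)) := by positivity
  refine hpos.trans_le (le_liminf_of_le (IsBoundedUnder.isCoboundedUnder_ge ⟨1, ?_⟩) ?_)
  · refine eventually_map.2 (Eventually.of_forall fun n => ?_)
    change 1 / ((n : ℝ) + 1) * _ ≤ 1
    rw [one_div_mul_eq_div, div_le_one (by positivity)]
    exact_mod_cast hle n
  · filter_upwards [eventually_ge_atTop (2 * C + 1)] with n hn
    rw [one_div_mul_eq_div, div_le_div_iff₀ (by positivity) (by positivity), one_mul]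
    have h1 : n < (C + 1) * (n / (C + 1)) + (C + 1) := by
      have := Nat.div_add_mod n (C + 1)
      have := Nat.mod_lt n (show 0 < C + 1 by omega)
      omega
    have h2 : n + 1 ≤ 2 * ((C + 1) * {m ∈ A | m ≤ n}.ncard) := by
      have := Nat.mul_le_mul_left (C + 1) (hcard n)
      omega
    calc (n : ℝ) + 1 ≤ 2 * (((C : ℝ) + 1) * {m ∈ A | m ≤ n}.ncard) := by exact_mod_cast h2
      _ = _ := by ring

/-- For each `n` the inequality concerns finitely many integers only; in `isMeagre_UFM` this makes
it an open condition on `f`. -/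
lemma lowerDensity_nonpos_of_frequently {A : Set ℕ}
    (h : ∀ k N : ℕ, ∃ n ≥ N, {m ∈ A | m ≤ n}.ncard * (k + 1) < n + 1) :
    lowerDensity A ≤ 0 := by
  refine le_of_forall_gt_imp_ge_of_dense fun a ha => ?_
  obtain ⟨k, hk⟩ := exists_nat_one_div_lt ha
  refine liminf_le_of_frequently_le (frequently_atTop.2 fun N => ?_) ⟨0, ?_⟩
  · obtain ⟨n, hn, hlt⟩ := h k N
    refine ⟨n, hn, le_trans ?_ hk.le⟩
    rw [one_div_mul_eq_div, div_le_div_iff₀ (by positivity) (by positivity), one_mul]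
    exact_mod_cast hlt.le
  · exact eventually_map.2 (Eventually.of_forall fun n => by positivity)

/-- The naturals split into consecutive blocks, the `b`-th of length `ν₂(b) + 1`; a number in the
`b`-th block is labelled `ν₂(b)`. The right ends of the blocks with a given label have positive
lower density. -/
lemma exists_block_labelling : ∃ J : ℕ → ℕ, ∀ j K : ℕ, ∃ (g : ℕ → ℕ) (C : ℕ), StrictMono g ∧
    ∀ i, K ≤ g i ∧ g i ≤ C * (i + 1) ∧ ∀ m, g i < m + j → m ≤ g i → J m = j := by
  -- `t b` is the right end of the `b`-th block: the lengths `ν₂(i) + 1`, `1 ≤ i ≤ b`, add up to `b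
  -- + ν₂(b!)`.
  let t : ℕ → ℕ := fun b => b + padicValNat 2 b.factorial
  have ht : ∀ b, t (b + 1) = t b + 1 + padicValNat 2 (b + 1) := fun b => by
    simp only [t, Nat.factorial_succ]
    rw [padicValNat.mul (by omega) (Nat.factorial_ne_zero b)]
    omega
  have hmono : StrictMono t := strictMono_nat_of_lt_succ fun b => by rw [ht]; omega
  have hex : ∀ m, ∃ b, m ≤ t b := fun m => ⟨m, hmono.le_apply⟩
  -- The blocks labelled `j` are those with index `2 ^ j` times an odd number; the shift by `K`
  -- skips the early ones. The bound `t b ≤ 2 * b` yields the linear constant.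
  refine ⟨fun m => padicValNat 2 (Nat.find (hex m)), fun j K =>
    ⟨fun i => t (2 ^ j * (2 * (i + K) + 1)), 2 ^ (j + 1) * (2 * K + 2), ?_, fun i => ⟨?_, ?_, ?_⟩⟩⟩
  · refine hmono.comp fun a b hab => ?_
    have : 0 < 2 ^ j := by positivity
    gcongr
  · have h1 : 1 ≤ 2 ^ j := Nat.one_le_two_pow
    calc K ≤ 1 * (2 * (i + K) + 1) := by omega
      _ ≤ 2 ^ j * (2 * (i + K) + 1) := by gcongr
      _ ≤ _ := hmono.le_apply
  · have h1 : ∀ b, t b ≤ 2 * b := fun b => by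
      have := padicValNat_factorial_le (p := 2) b
      simp only [t]
      omega
    refine (h1 _).trans ?_
    rw [pow_succ]
    have h2 : 2 * (i + K) + 1 ≤ (2 * K + 2) * (i + 1) := by nlinarith [Nat.zero_le (K * i)]
    calc 2 * (2 ^ j * (2 * (i + K) + 1)) = 2 ^ j * 2 * (2 * (i + K) + 1) := by ring
      _ ≤ 2 ^ j * 2 * ((2 * K + 2) * (i + 1)) := by gcongr
      _ = _ := by ring
  · intro m hm1 hm2
    dsimp only at hm1 hm2 ⊢
    have hv : padicValNat 2 (2 ^ j * (2 * (i + K) + 1)) = j := by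
      rw [padicValNat.mul (by positivity) (by omega), padicValNat.prime_pow,
        padicValNat.eq_zero_of_not_dvd (by omega), add_zero]
    obtain ⟨b, hb⟩ : ∃ b, 2 ^ j * (2 * (i + K) + 1) = b + 1 :=
      Nat.exists_eq_succ_of_ne_zero (by positivity)
    rw [hb] at hm1 hm2 hv
    have : Nat.find (hex m) = b + 1 := by
      rw [Nat.find_eq_iff]
      refine ⟨hm2, fun c hc => ?_⟩
      have h3 : t c ≤ t b := hmono.monotone (by omega)
      have := ht b
      omega
    rw [this, hv]

/-! ### Rare successors and ancestors. -/

noncomputable section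

namespace WeightedTree

variable {T : Type*} (M : WeightedTree T)

/-- The distance of a vertex from the root. -/
def level (x : T) : ℕ := M.graph.dist M.root x

lemma level_of_mem_S {x y : T} (h : y ∈ M.S x) : M.level y = M.level x + 1 := M.dist_of_mem_S h

lemma level_vertex (e : M.Boundary) (n : ℕ) : M.level (e.vertex n) = n := M.dist_vertex e n

lemma vertex_succ_mem (e : M.Boundary) (n : ℕ) : e.vertex (n + 1) ∈ M.S (e.vertex n) := e.2.2 n

open Classical in
/-- The parent of a vertex, with the junk value `y` at the root. -/
def parent (y : T) : T := if h : ∃ x, y ∈ M.S x then h.choose else y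

lemma parent_eq {x y : T} (h : y ∈ M.S x) : M.parent y = x := by
  have hex : ∃ x, y ∈ M.S x := ⟨x, h⟩
  rw [parent, dif_pos hex]
  exact HarmonicTree.IsParent.unique M.isTree (M.isParent_of_mem_S hex.choose_spec)
    (M.isParent_of_mem_S h)

lemma two_le_card_S (x : T) : 2 ≤ (M.S x).card := by
  have h := M.two_le_successors x
  rwa [Set.ncard_eq_toFinset_card _ (M.finite_successorSet x)] at h

lemma exists_rare (x : T) : ∃ y ∈ M.S x, ∀ z ∈ M.S x, M.q x y ≤ M.q x z :=
  Finset.exists_min_image _ _ (Finset.card_pos.1 (by have := M.two_le_card_S x; omega))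

/-- A successor of `x` of least transition probability. -/
def rare (x : T) : T := (M.exists_rare x).choose

lemma rare_mem (x : T) : M.rare x ∈ M.S x := (M.exists_rare x).choose_spec.1

lemma q_rare_pos (x : T) : 0 < M.q x (M.rare x) := M.q_pos_of_mem (M.rare_mem x)

/-- A minimum is at most the average, and at least two probabilities add up to 1. -/
lemma q_rare_le (x : T) : M.q x (M.rare x) ≤ 1 / 2 := by
  have h := Finset.card_nsmul_le_sum (M.S x) (M.q x) _ (M.exists_rare x).choose_spec.2
  rw [M.sum_S, nsmul_eq_mul] at h
  have h2 : (2 : ℝ) ≤ (M.S x).card := by exact_mod_cast M.two_le_card_S x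
  have h3 := M.q_rare_pos x
  change _ * M.q x (M.rare x) ≤ 1 at h
  nlinarith

/-- The ancestor at level `n` of a vertex of level at least `n`. -/
def ancestor (n : ℕ) (y : T) : T := M.parent^[M.level y - n] y

lemma ancestor_of_level_eq {n : ℕ} {y : T} (h : M.level y = n) : M.ancestor n y = y := by
  simp [ancestor, h]

lemma ancestor_of_mem_S {n : ℕ} {x y : T} (h : y ∈ M.S x) (hn : n ≤ M.level x) :
    M.ancestor n y = M.ancestor n x := by
  rw [ancestor, ancestor, M.level_of_mem_S h, Nat.succ_sub hn, Function.iterate_succ_apply,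
    M.parent_eq h]

lemma ancestor_vertex (e : M.Boundary) {n m : ℕ} (h : n ≤ m) :
    M.ancestor n (e.vertex m) = e.vertex n := by
  induction m, h using Nat.le_induction with
  | base => exact M.ancestor_of_level_eq (M.level_vertex e n)
  | succ m hm ih =>
    rw [M.ancestor_of_mem_S (M.vertex_succ_mem e m) (by rwa [M.level_vertex]), ih]

lemma finite_range_vertex (n : ℕ) : (Set.range fun e : M.Boundary => e.vertex n).Finite := by
  induction n with
  | zero =>
    refine (Set.finite_singleton M.root).subset ?_
    rintro _ ⟨e, rfl⟩
    exact e.2.1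
  | succ n ih =>
    refine (ih.biUnion fun x _ => (M.S x).finite_toSet).subset ?_
    rintro _ ⟨e, rfl⟩
    exact Set.mem_biUnion ⟨e, rfl⟩ (M.vertex_succ_mem e n)

/-! ### Free continuation of harmonic functions. -/

section harmonic

variable {𝕜 : Type*} [RCLike 𝕜] {E : Type*} [AddCommGroup E] [Module 𝕜 E]

lemma q_rare_cast_ne_zero (x : T) : ((M.q x (M.rare x) : ℝ) : 𝕜) ≠ 0 :=
  RCLike.ofReal_ne_zero.2 (M.q_rare_pos x).ne'

lemma sum_S_cast (x : T) : ∑ y ∈ M.S x, ((M.q x y : ℝ) : 𝕜) = 1 := by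
  have := congrArg (fun r : ℝ => (r : 𝕜)) (M.sum_S x)
  simpa using this

open Classical in
lemma sum_eq_rare_add (x : T) (f : T → E) :
    ∑ y ∈ M.S x, ((M.q x y : ℝ) : 𝕜) • f y = ((M.q x (M.rare x) : ℝ) : 𝕜) • f (M.rare x) +
      ∑ y ∈ (M.S x).erase (M.rare x), ((M.q x y : ℝ) : 𝕜) • f y :=
  (Finset.add_sum_erase _ _ (M.rare_mem x)).symm

/-- Both `f` and the constant `c` satisfy the mean equation at `x`; all terms but the rare one
cancel, and its weight is non-zero. -/
lemma eq_const_of_harmonic {f : T → E} (hf : f ∈ M.HQ E 𝕜) {x : T} {c : E} (hx : f x = c)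
    (h : ∀ y ∈ M.S x, y ≠ M.rare x → f y = c) : f (M.rare x) = c := by
  classical
  have h1 : ∑ y ∈ M.S x, ((M.q x y : ℝ) : 𝕜) • f y = ∑ y ∈ M.S x, ((M.q x y : ℝ) : 𝕜) • c := by
    rw [← hf x, ← Finset.sum_smul, M.sum_S_cast, one_smul, hx]
  rw [M.sum_eq_rare_add x f, M.sum_eq_rare_add x fun _ => c,
    Finset.sum_congr rfl fun y hy => by
      rw [h y (Finset.mem_of_mem_erase hy) (Finset.ne_of_mem_erase hy)]] at h1
  exact (IsUnit.mk0 _ (M.q_rare_cast_ne_zero (𝕜 := 𝕜) x)).smul_left_cancel.1 (add_right_cancel h1)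

/-- A harmonic function can be continued beyond level `N` with arbitrary values at all vertices
that are not the rarest successor of their parent. -/
lemma exists_harmonic_extension {f₀ : T → E} (h₀ : f₀ ∈ M.HQ E 𝕜) (N : ℕ) (τ : T → E) :
    ∃ f ∈ M.HQ E 𝕜, (∀ x, M.level x ≤ N → f x = f₀ x) ∧
      ∀ x, N ≤ M.level x → ∀ y ∈ M.S x, y ≠ M.rare x → f y = τ y := by
  classical
  -- Only the values of `F n` at level `n` matter. At a rare successor the mean equation at the
  -- parent is solved for the one unknown value.
  let F : ℕ → T → E := fun n => Nat.rec f₀ (fun n Fn y =>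
    if n < N then f₀ y else if y = M.rare (M.parent y) then
      ((M.q (M.parent y) y : ℝ) : 𝕜)⁻¹ • (Fn (M.parent y) -
        ∑ z ∈ (M.S (M.parent y)).erase y, ((M.q (M.parent y) z : ℝ) : 𝕜) • τ z)
    else τ y) n
  have hF : ∀ n y, F (n + 1) y = if n < N then f₀ y else if y = M.rare (M.parent y) then
      ((M.q (M.parent y) y : ℝ) : 𝕜)⁻¹ • (F n (M.parent y) -
        ∑ z ∈ (M.S (M.parent y)).erase y, ((M.q (M.parent y) z : ℝ) : 𝕜) • τ z)
    else τ y := fun n y => rfl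
  have hlow : ∀ x, M.level x ≤ N → F (M.level x) x = f₀ x := by
    intro x hx
    rcases h : M.level x with _ | n
    · rfl
    · rw [hF, if_pos (by omega)]
  have hτ : ∀ x, N ≤ M.level x → ∀ y ∈ M.S x, y ≠ M.rare x → F (M.level y) y = τ y := by
    intro x hx y hy hne
    rw [M.level_of_mem_S hy, hF, if_neg (by omega), M.parent_eq hy, if_neg hne]
  refine ⟨fun y => F (M.level y) y, fun x => ?_, hlow, hτ⟩
  rcases lt_or_ge (M.level x) N with hx | hx
  · dsimp only
    rw [hlow x hx.le, h₀ x]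
    exact Finset.sum_congr rfl fun y hy => by
      rw [hlow y (by rw [M.level_of_mem_S hy]; omega)]
  · rw [M.sum_eq_rare_add, Finset.sum_congr rfl fun y hy => by
      rw [hτ x hx y (Finset.mem_of_mem_erase hy) (Finset.ne_of_mem_erase hy)]]
    dsimp only
    rw [M.level_of_mem_S (M.rare_mem x), hF, if_neg (by omega), M.parent_eq (M.rare_mem x),
      if_pos rfl, smul_inv_smul₀ (M.q_rare_cast_ne_zero (𝕜 := 𝕜) x), sub_add_cancel]

/-- A harmonic function that agrees with `h` at the non-rare vertices of the levels
`n + 1, …, n + k`, where `h` is constant along descendants, agrees with `h` at level `n + k` of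
every boundary point that makes a non-rare step between the levels `n` and `n + k`. -/
lemma harmonic_eq_of_exists_not_rare {f h : T → E} (hf : f ∈ M.HQ E 𝕜) {n k : ℕ}
    (hh : ∀ x, n ≤ M.level x → M.level x < n + k → ∀ y ∈ M.S x, h y = h x)
    (hfh : ∀ x, n ≤ M.level x → M.level x < n + k → ∀ y ∈ M.S x, y ≠ M.rare x → f y = h y)
    (e : M.Boundary) (he : ∃ i < k, e.vertex (n + i + 1) ≠ M.rare (e.vertex (n + i))) :
    f (e.vertex (n + k)) = h (e.vertex (n + k)) := by
  induction k with
  | zero => simp at he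
  | succ k ih =>
    have hl : M.level (e.vertex (n + k)) = n + k := M.level_vertex e _
    have hmem := M.vertex_succ_mem e (n + k)
    -- If the last step is rare, an earlier one is not, so `f = h` already holds at the parent; all
    -- non-rare siblings carry that same value, and `eq_const_of_harmonic` passes it on.
    by_cases hr : e.vertex (n + k + 1) = M.rare (e.vertex (n + k))
    · have h1 : f (e.vertex (n + k)) = h (e.vertex (n + k)) := by
        refine ih (fun x h1 h2 => hh x h1 (by omega)) (fun x h1 h2 => hfh x h1 (by omega)) ?_
        obtain ⟨i, hi, hne⟩ := he
        rcases Nat.lt_succ_iff_lt_or_eq.1 hi with hi | rfl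
        · exact ⟨i, hi, hne⟩
        · exact absurd hr hne
      have h2 := M.eq_const_of_harmonic hf h1 fun y hy hne =>
        (hfh _ (by omega) (by omega) y hy hne).trans (hh _ (by omega) (by omega) y hy)
      rw [← hr] at h2
      exact h2.trans (hh _ (by omega) (by omega) _ hmem).symm
    · exact hfh _ (by omega) (by omega) _ hmem hr

end harmonic

/-! ### Probability of rare steps, and distances in `L⁰`. -/

section measure

lemma sector_vertex (e : M.Boundary) (n : ℕ) :
    M.sector (e.vertex n) = {e' | e'.vertex n = e.vertex n} := by
  ext e'
  constructor
  · rintro ⟨m, hm⟩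
    have := M.level_vertex e' m
    rw [hm, M.level_vertex] at this
    exact this ▸ hm
  · exact fun h => ⟨n, h⟩

/-- The vertex at level `n + k` determines its ancestors. This gives measurability, and lets
`measure_rare_step_le` be applied to the past of the walk. -/
lemma setOf_rare_steps_eq (n k : ℕ) :
    {e : M.Boundary | ∀ i < k, e.vertex (n + i + 1) = M.rare (e.vertex (n + i))} =
      {e | e.vertex (n + k) ∈
        {y | ∀ i < k, M.ancestor (n + i + 1) y = M.rare (M.ancestor (n + i) y)}} := by
  ext e
  refine forall₂_congr fun i hi => ?_
  rw [M.ancestor_vertex e (by omega), M.ancestor_vertex e (by omega)]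

variable [Countable T]

lemma measurable_vertex [MeasurableSpace T] (n : ℕ) :
    Measurable fun e : M.Boundary => e.vertex n :=
  measurable_to_countable' fun x => M.measurableSet_vertex_eq n x

lemma measurableSet_vertex_mem (n : ℕ) (W : Set T) :
    MeasurableSet {e : M.Boundary | e.vertex n ∈ W} := by
  let : MeasurableSpace T := ⊤
  exact M.measurable_vertex n MeasurableSpace.measurableSet_top

lemma measure_vertex_eq_rare_le (n : ℕ) (x : T) :
    M.boundaryMeasure {e | e.vertex n = x ∧ e.vertex (n + 1) = M.rare x} ≤
      2⁻¹ * M.boundaryMeasure {e | e.vertex n = x} := by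
  rcases Set.eq_empty_or_nonempty {e : M.Boundary | e.vertex n = x ∧ e.vertex (n + 1) = M.rare x}
    with h | ⟨e, rfl, he⟩
  · simp [h]
  · have hq : ENNReal.ofReal (M.q (e.vertex n) (e.vertex (n + 1))) ≤ 2⁻¹ := by
      rw [← ENNReal.ofReal_ofNat 2, ← ENNReal.ofReal_inv_of_pos two_pos, he]
      exact ENNReal.ofReal_le_ofReal (by simpa using M.q_rare_le (e.vertex n))
    have h1 := M.boundaryMeasure_sector e n
    have h2 := M.boundaryMeasure_sector e (n + 1)
    have h0 : ∀ j, 0 ≤ M.q (e.vertex j) (e.vertex (j + 1)) := fun j =>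
      (M.q_pos_of_mem (M.vertex_succ_mem e j)).le
    rw [Finset.prod_range_succ, ENNReal.ofReal_mul (Finset.prod_nonneg fun j _ => h0 j), ← h1,
      sector_vertex, sector_vertex, mul_comm] at h2
    refine le_trans (measure_mono ?_) (h2.le.trans ?_)
    · exact fun e' he' => he'.2.trans he.symm
    · gcongr

lemma measure_rare_step_le (n : ℕ) (W : Set T) :
    M.boundaryMeasure {e | e.vertex n ∈ W ∧ e.vertex (n + 1) = M.rare (e.vertex n)} ≤
      2⁻¹ * M.boundaryMeasure {e | e.vertex n ∈ W} := by
  have h1 : {e : M.Boundary | e.vertex n ∈ W ∧ e.vertex (n + 1) = M.rare (e.vertex n)} =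
      ⋃ x : W, {e | e.vertex n = (x : T) ∧ e.vertex (n + 1) = M.rare x} := by
    ext e
    simp only [Set.mem_ofPred_eq, Set.mem_iUnion]
    exact ⟨fun h => ⟨⟨_, h.1⟩, rfl, h.2⟩, fun ⟨x, hx, h⟩ => ⟨hx ▸ x.2, hx ▸ h⟩⟩
  have h2 : {e : M.Boundary | e.vertex n ∈ W} = ⋃ x : W, {e | e.vertex n = (x : T)} := by
    ext e
    simp
  have hdisj : Pairwise (Function.onFun Disjoint
      fun x : W => {e : M.Boundary | e.vertex n = (x : T)}) := fun x y hxy =>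
    Set.disjoint_left.2 fun e (hx : e.vertex n = x) (hy : e.vertex n = y) =>
      hxy (Subtype.ext (hx.symm.trans hy))
  rw [h1, h2, measure_iUnion hdisj fun x => M.measurableSet_vertex_eq n x,
    ← ENNReal.tsum_mul_left]
  exact (measure_iUnion_le _).trans
    (ENNReal.tsum_le_tsum fun x => M.measure_vertex_eq_rare_le n x)

/-- Whatever the past, the next step is rare with conditional probability at most 1/2. -/
lemma measure_rare_steps_le (n k : ℕ) :
    M.boundaryMeasure {e | ∀ i < k, e.vertex (n + i + 1) = M.rare (e.vertex (n + i))} ≤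
      2⁻¹ ^ k := by
  induction k with
  | zero => simp
  | succ k ih =>
    have h := M.measure_rare_step_le (n + k)
      {y | ∀ i < k, M.ancestor (n + i + 1) y = M.rare (M.ancestor (n + i) y)}
    rw [← setOf_rare_steps_eq] at h
    rw [pow_succ']
    refine (measure_mono fun e he => ?_).trans (h.trans (by gcongr))
    refine ⟨?_, he k (by omega)⟩
    have h' : e ∈ {e : M.Boundary |
      ∀ i < k, e.vertex (n + i + 1) = M.rare (e.vertex (n + i))} := fun i hi => he i (by omega)
    rw [setOf_rare_steps_eq] at h'
    exact h'

lemma measurableSet_rare_steps (n k : ℕ) : MeasurableSet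
    {e : M.Boundary | ∀ i < k, e.vertex (n + i + 1) = M.rare (e.vertex (n + i))} := by
  rw [setOf_rare_steps_eq]
  exact M.measurableSet_vertex_mem _ _

variable {E : Type*} [MetricSpace E]

lemma dist_omega (n m : ℕ) (f g : T → E) : dist (M.omega n f) (M.omega m g) =
    ∫ e, dist (f (e.vertex n)) (g (e.vertex m)) / (1 + dist (f (e.vertex n)) (g (e.vertex m)))
      ∂M.boundaryMeasure := by
  rw [L0_dist_def]
  refine integral_congr_ae ?_
  filter_upwards [AEEqFun.coeFn_mk _ (M.aestronglyMeasurable_omega n f),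
    AEEqFun.coeFn_mk _ (M.aestronglyMeasurable_omega m g)] with e h1 h2
  simp only [omega, h1, h2]

lemma integrable_omega (n m : ℕ) (f g : T → E) : Integrable (fun e : M.Boundary =>
    dist (f (e.vertex n)) (g (e.vertex m)) / (1 + dist (f (e.vertex n)) (g (e.vertex m))))
      M.boundaryMeasure := by
  refine (M.integrable_L0 (M.omega n f) (M.omega m g)).congr ?_
  filter_upwards [AEEqFun.coeFn_mk _ (M.aestronglyMeasurable_omega n f),
    AEEqFun.coeFn_mk _ (M.aestronglyMeasurable_omega m g)] with e h1 h2
  simp only [omega, h1, h2]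

lemma omega_congr {n m : ℕ} {f g : T → E}
    (h : ∀ e : M.Boundary, f (e.vertex n) = g (e.vertex m)) : M.omega n f = M.omega m g := by
  rw [← dist_eq_zero, dist_omega]
  simp [h]

lemma omega_const_ne {a b : E} (h : a ≠ b) :
    (M.omega 0 fun _ => a) ≠ M.omega 0 fun _ => b := by
  intro hab
  rw [← dist_eq_zero, dist_omega] at hab
  have hd : 0 < dist a b := dist_pos.2 h
  have : 0 < dist a b / (1 + dist a b) := by positivity
  simp [integral_const] at hab
  rcases hab with hab | hab
  · exact h hab
  · linarith

lemma dist_omega_le {n m : ℕ} {f g : T → E} {s : Set M.Boundary} (hs : MeasurableSet s)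
    (h : ∀ e ∉ s, f (e.vertex n) = g (e.vertex m)) :
    dist (M.omega n f) (M.omega m g) ≤ M.boundaryMeasure.real s := by
  rw [dist_omega, ← integral_indicator_one hs]
  refine integral_mono (M.integrable_omega n m f g)
    ((integrable_const (1 : ℝ)).indicator hs) fun e => ?_
  by_cases he : e ∈ s
  · have h0 := dist_nonneg (x := f (e.vertex n)) (y := g (e.vertex m))
    rw [Set.indicator_of_mem he, Pi.one_apply]
    change _ / (1 + _) ≤ (1 : ℝ)
    rw [div_le_one (by positivity)]
    linarith
  · simp [Set.indicator_of_notMem he, h e he]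

lemma continuous_omega (n : ℕ) : Continuous fun f : T → E => M.omega n f := by
  refine continuous_iff_continuousAt.2 fun f => tendsto_iff_dist_tendsto_zero.2 ?_
  simp only [dist_omega]
  rw [← integral_zero M.Boundary ℝ (μ := M.boundaryMeasure)]
  -- Dominated convergence along `𝓝 f` is available because `T` is countable, so that this filter is
  -- countably generated.
  refine tendsto_integral_filter_of_dominated_convergence (fun _ => 1)
    (Eventually.of_forall fun g => (M.integrable_omega n n g f).aestronglyMeasurable)
    (Eventually.of_forall fun g => Eventually.of_forall fun e => ?_) (integrable_const 1)
    (Eventually.of_forall fun e => ?_)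
  · have h0 := dist_nonneg (x := g (e.vertex n)) (y := f (e.vertex n))
    rw [Real.norm_of_nonneg (by positivity), div_le_one (by positivity)]
    linarith
  · have hd : Tendsto (fun g : T → E => dist (g (e.vertex n)) (f (e.vertex n))) (𝓝 f) (𝓝 0) := by
      have : Continuous fun g : T → E => dist (g (e.vertex n)) (f (e.vertex n)) := by fun_prop
      simpa using this.tendsto f
    have h1 := hd.div (hd.const_add 1) (by simp)
    rw [zero_div] at h1
    exact h1

variable {𝕜 : Type*} [RCLike 𝕜] [AddCommGroup E] [Module 𝕜 E]

lemma dist_omega_le_of_eq_on_block {f h : T → E} (hf : f ∈ M.HQ E 𝕜) {n k : ℕ}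
    (hh : ∀ x, n ≤ M.level x → M.level x < n + k → ∀ y ∈ M.S x, h y = h x)
    (hfh : ∀ x, n ≤ M.level x → M.level x < n + k → ∀ y ∈ M.S x, y ≠ M.rare x → f y = h y) :
    dist (M.omega (n + k) f) (M.omega (n + k) h) ≤ 2⁻¹ ^ k := by
  refine (M.dist_omega_le (M.measurableSet_rare_steps n k) fun e he =>
    M.harmonic_eq_of_exists_not_rare hf hh hfh e ?_).trans ?_
  · simpa using he
  · refine ENNReal.toReal_le_of_le_ofReal (by positivity) ((M.measure_rare_steps_le n k).trans ?_)
    rw [ENNReal.ofReal_pow (by positivity), ENNReal.ofReal_inv_of_pos two_pos,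
      ENNReal.ofReal_ofNat]

end measure

/-! ### Density in `L⁰` of functions of one vertex. -/

section density

variable [Countable T]

/-- The filtration of `∂T` generated by the vertices at the levels `n`. -/
def vertexFiltration : Filtration ℕ (inferInstance : MeasurableSpace M.Boundary) where
  seq n := MeasurableSpace.comap (fun e : M.Boundary => e.vertex n) ⊤
  mono' n m hnm := by
    rintro _ ⟨W, -, rfl⟩
    refine ⟨M.ancestor n ⁻¹' W, MeasurableSpace.measurableSet_top, ?_⟩
    ext e
    simp [M.ancestor_vertex e hnm]
  le' n := by
    rintro _ ⟨W, -, rfl⟩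
    exact M.measurableSet_vertex_mem n W

lemma iSup_vertexFiltration :
    ⨆ n, M.vertexFiltration n = (inferInstance : MeasurableSpace M.Boundary) := by
  refine le_antisymm (iSup_le M.vertexFiltration.le) (MeasurableSpace.generateFrom_le ?_)
  rintro _ ⟨x, rfl⟩
  have : M.sector x = ⋃ n, {e | e.vertex n = x} := by
    ext e
    simp [sector]
  rw [this]
  refine MeasurableSet.iUnion fun n => le_iSup (fun n => M.vertexFiltration n) n _ ?_
  exact ⟨{x}, MeasurableSpace.measurableSet_top, rfl⟩

/-- A measurable `ℕ`-valued function on `∂T` is almost everywhere the eventual value of functions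
that depend on one vertex only. -/
lemma exists_ae_eventually_eq {ι : M.Boundary → ℕ} (hι : Measurable ι) :
    ∃ c : ℕ → T → ℕ, ∀ᵐ e ∂M.boundaryMeasure, ∀ᶠ n in atTop, c n (e.vertex n) = ι e := by
  -- The reciprocal is bounded, hence integrable, and still determines `ι`. Lévy's upward theorem
  -- then applies.
  let g : M.Boundary → ℝ := fun e => ((ι e : ℝ) + 1)⁻¹
  have hg : Measurable g := by
    have : Measurable fun k : ℕ => ((k : ℝ) + 1)⁻¹ := Measurable.of_discrete
    exact this.comp hι
  have hint : Integrable g M.boundaryMeasure := by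
    refine Integrable.of_bound (C := 1) hg.aestronglyMeasurable (Eventually.of_forall fun e => ?_)
    rw [Real.norm_of_nonneg (by positivity)]
    exact inv_le_one_of_one_le₀ (by simp)
  have hlim := hint.tendsto_ae_condExp (ℱ := M.vertexFiltration)
    (by rw [iSup_vertexFiltration]; exact hg.stronglyMeasurable)
  have hfac : ∀ n, ∃ φ : T → ℝ,
      M.boundaryMeasure[g | M.vertexFiltration n] = φ ∘ fun e : M.Boundary => e.vertex n := by
    intro n
    let : MeasurableSpace T := ⊤
    have h : StronglyMeasurable[MeasurableSpace.comap (fun e : M.Boundary => e.vertex n) ⊤]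
      (M.boundaryMeasure[g | M.vertexFiltration n]) := stronglyMeasurable_condExp
    exact (Function.factorsThrough_iff _).1 h.factorsThrough
  choose φ hφ using hfac
  -- Along almost every `e` the bracket tends to `ι e + 1 / 2`, an interior point of the interval
  -- where the floor is `ι e`.
  refine ⟨fun n x => ⌊(φ n x)⁻¹ - 1 / 2⌋₊, ?_⟩
  filter_upwards [hlim] with e he
  simp only [hφ, Function.comp_apply, g] at he
  have h1 := he.inv₀ (by positivity)
  rw [inv_inv] at h1
  filter_upwards [h1.eventually (lt_mem_nhds (show (ι e : ℝ) + 1 / 2 < ι e + 1 by linarith)),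
    h1.eventually (gt_mem_nhds (show (ι e : ℝ) + 1 < ι e + 3 / 2 by linarith))] with n h2 h3
  have h0 : (0 : ℝ) ≤ ι e := by positivity
  rw [Nat.floor_eq_iff (by linarith)]
  constructor <;> linarith

-- Take the first index `i` with `denseSeq E i` within `ε / 2` of `F e`, and approximate this
-- measurable index by functions of one vertex. Finite support keeps the family of targets
-- countable.
open TopologicalSpace in
lemma exists_dist_omega_lt {E : Type*} [MetricSpace E] [SeparableSpace E] [Nonempty E]
    (F : M.L0 E) {ε : ℝ} (hε : 0 < ε) :
    ∃ (n : ℕ) (c : T →₀ ℕ), dist (M.omega n (denseSeq E ∘ c)) F < ε := by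
  classical
  have hex : ∀ e, ∃ i, dist (F e) (denseSeq E i) < ε / 2 := fun e =>
    (denseRange_denseSeq E).exists_dist_lt (F e) (half_pos hε)
  have hι : Measurable fun e => Nat.find (hex e) := measurable_find hex fun i =>
    measurableSet_lt (F.stronglyMeasurable.dist stronglyMeasurable_const).measurable
      measurable_const
  obtain ⟨c, hc⟩ := M.exists_ae_eventually_eq hι
  let K : M.Boundary → ℝ := fun e => dist (denseSeq E (Nat.find (hex e))) (F e) /
    (1 + dist (denseSeq E (Nat.find (hex e))) (F e))
  have hK : ∫ e, K e ∂M.boundaryMeasure ≤ ε / 2 := by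
    have hb : ∀ᵐ e ∂M.boundaryMeasure, ‖K e‖ ≤ ε / 2 := Eventually.of_forall fun e => ?_
    · have h := norm_integral_le_of_norm_le_const hb
      rw [probReal_univ, mul_one] at h
      exact (le_abs_self _).trans h
    have h0 : 0 ≤ dist (denseSeq E (Nat.find (hex e))) (F e) := dist_nonneg
    have h1 := Nat.find_spec (hex e)
    rw [dist_comm] at h1
    rw [Real.norm_of_nonneg (by positivity)]
    exact (div_le_self h0 (by linarith)).trans h1.le
  have hlim : Tendsto (fun n => dist (M.omega n (denseSeq E ∘ c n)) F) atTop
      (𝓝 (∫ e, K e ∂M.boundaryMeasure)) := by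
    simp only [L0_dist_def]
    refine tendsto_integral_of_dominated_convergence (fun _ => 1)
      (fun n => (M.integrable_L0 _ _).aestronglyMeasurable) (integrable_const 1)
      (fun n => Eventually.of_forall fun e => ?_) ?_
    · have h0 := dist_nonneg (x := M.omega n (denseSeq E ∘ c n) e) (y := F e)
      rw [Real.norm_of_nonneg (by positivity), div_le_one (by positivity)]
      linarith
    · filter_upwards [hc, ae_all_iff.2 fun n =>
        AEEqFun.coeFn_mk _ (M.aestronglyMeasurable_omega n (denseSeq E ∘ c n))] with e he1 he2
      refine tendsto_const_nhds.congr' ?_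
      filter_upwards [he1] with n hn
      simp only [omega, K]
      rw [he2 n, Function.comp_apply, hn]
  obtain ⟨n, hn⟩ := (hlim.eventually (gt_mem_nhds (hK.trans_lt (half_lt_self hε)))).exists
  -- Only finitely many vertices are reached at level `n`; setting the others to 0 does not change
  -- the class.
  refine ⟨n, Finsupp.onFinset (M.finite_range_vertex n).toFinset
    (fun x => if x ∈ Set.range fun e : M.Boundary => e.vertex n then c n x else 0) ?_, ?_⟩
  · intro x hx
    rw [Set.Finite.mem_toFinset]
    by_contra h
    exact hx (if_neg h)
  · rwa [M.omega_congr (n := n) (m := n) (g := denseSeq E ∘ c n) fun e => by simp]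

end density

/-! ### Existence, density and meagerness. -/

section main

variable {𝕜 : Type*} [RCLike 𝕜] {E : Type*} [MetricSpace E] [AddCommGroup E]
  [Module 𝕜 E]

/-- Functions agreeing with `f₀` up to level `N` converge to it pointwise as `N → ∞`. -/
lemma dense_of_exists_eq_on_levels {s : Set (M.HQ E 𝕜)}
    (h : ∀ (f₀ : M.HQ E 𝕜) (N : ℕ), ∃ f ∈ s, ∀ x, M.level x ≤ N → f.1 x = f₀.1 x) :
    Dense s := by
  intro f₀
  choose f hf hfx using h f₀
  refine mem_closure_of_tendsto (b := atTop) (tendsto_subtype_rng.2 (tendsto_pi_nhds.2 fun x => ?_))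
    (Eventually.of_forall hf)
  refine tendsto_const_nhds.congr' ?_
  filter_upwards [eventually_ge_atTop (M.level x)] with N hN
  exact (hfx N x hN).symm

variable [Countable T]

open TopologicalSpace in
lemma exists_mem_UFM_eq_on_levels [SeparableSpace E] (f₀ : M.HQ E 𝕜) (N : ℕ) :
    ∃ f ∈ M.UFM E 𝕜, ∀ x, M.level x ≤ N → f.1 x = f₀.1 x := by
  obtain ⟨J, hJ⟩ := exists_block_labelling
  obtain ⟨d, hd⟩ := exists_surjective_nat (ℕ × (T →₀ ℕ))
  -- A label is a pair: the first entry numbers the target. The second does not enter `h`; it only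
  -- makes the block long, hence the error small, since `Nat.pair i l ≥ l`.
  let h : ℕ → T → E := fun j y =>
    denseSeq E ((d j.unpair.1).2 (M.ancestor (d j.unpair.1).1 y))
  obtain ⟨f, hf, hlow, hτ⟩ := M.exists_harmonic_extension f₀.2 N fun y => h (J (M.level y)) y
  refine ⟨⟨f, hf⟩, fun V hV ⟨v, hv⟩ => ?_, hlow⟩
  obtain ⟨r, hr, hball⟩ := Metric.isOpen_iff.1 hV v hv
  obtain ⟨m, c, hmc⟩ := M.exists_dist_omega_lt v (half_pos hr)
  obtain ⟨i, hi⟩ := hd (m, c)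
  obtain ⟨l, hl⟩ := exists_pow_lt_of_lt_one (half_pos hr) (show (2⁻¹ : ℝ) < 1 by norm_num)
  -- Each block then starts beyond `N`, where values are free, and beyond `m`, where the target is
  -- constant along descendants.
  obtain ⟨g, C, hg, hgC⟩ := hJ (Nat.pair i l) (max m N + Nat.pair i l)
  have hj : ∀ y, h (Nat.pair i l) y = denseSeq E (c (M.ancestor m y)) := fun y => by
    simp only [h, Nat.unpair_pair, hi]
  refine lowerDensity_pos_of_strictMono hg (fun b => hball ?_) fun b => (hgC b).2.1
  obtain ⟨hK, -, hlab⟩ := hgC b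
  obtain ⟨n, hn⟩ : ∃ n, g b = n + Nat.pair i l := ⟨g b - Nat.pair i l, by omega⟩
  rw [hn] at hK hlab ⊢
  have hmn : max m N ≤ n := by omega
  have hm : m ≤ n := (le_max_left _ _).trans hmn
  have hN : N ≤ n := (le_max_right _ _).trans hmn
  have h1 := M.dist_omega_le_of_eq_on_block hf (n := n) (k := Nat.pair i l)
    (h := h (Nat.pair i l))
    (fun x hx _ y hy => by rw [hj, hj, M.ancestor_of_mem_S hy (by omega)])
    (fun x hx hx' y hy hne => by
      have hly := M.level_of_mem_S hy
      rw [hτ x (by omega) y hy hne, hlab _ (by omega) (by omega)])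
  have h2 : M.omega (n + Nat.pair i l) (h (Nat.pair i l)) = M.omega m (denseSeq E ∘ c) :=
    M.omega_congr fun e => by
      rw [hj, M.ancestor_vertex e (by omega), Function.comp_apply]
  rw [h2] at h1
  have h3 : (2⁻¹ : ℝ) ^ Nat.pair i l ≤ 2⁻¹ ^ l :=
    pow_le_pow_of_le_one (by norm_num) (by norm_num) (Nat.right_le_pair i l)
  calc dist (M.omega (n + Nat.pair i l) f) v ≤ _ + _ := dist_triangle _ _ _
    _ < r / 2 + r / 2 := add_lt_add (h1.trans_lt (h3.trans_lt hl)) hmc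
    _ = r := add_halves r

lemma exists_tendsto_omega_const (f₀ : M.HQ E 𝕜) (N : ℕ) (c : E) :
    ∃ f : M.HQ E 𝕜, (∀ x, M.level x ≤ N → f.1 x = f₀.1 x) ∧
      Tendsto (fun n => M.omega n f.1) atTop (𝓝 (M.omega 0 fun _ => c)) := by
  obtain ⟨f, hf, hlow, hτ⟩ := M.exists_harmonic_extension f₀.2 N fun _ => c
  refine ⟨⟨f, hf⟩, hlow, (tendsto_add_atTop_iff_nat N).1 (tendsto_iff_dist_tendsto_zero.2 ?_)⟩
  refine squeeze_zero (fun _ => dist_nonneg) (fun k => ?_)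
    (tendsto_pow_atTop_nhds_zero_of_lt_one (r := (2⁻¹ : ℝ)) (by norm_num) (by norm_num))
  have h := M.dist_omega_le_of_eq_on_block hf (n := N) (k := k) (h := fun _ => c)
    (fun _ _ _ _ _ => rfl) fun x hx _ y hy hne => hτ x hx y hy hne
  rwa [add_comm, M.omega_congr (n := k + N) (m := 0) (f := fun _ => c) (g := fun _ => c)
    fun _ => rfl] at h

lemma isMeagre_UFM [Nontrivial E] : IsMeagre (M.UFM E 𝕜) := by
  obtain ⟨a, b, hab⟩ := exists_pair_ne E
  have hr : 0 < dist (M.omega 0 fun _ => b) (M.omega 0 fun _ => a) :=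
    dist_pos.2 (M.omega_const_ne hab.symm)
  set r := dist (M.omega 0 fun _ => b) (M.omega 0 fun _ => a) with hr_def
  -- The ball is closed so that missing it is an open condition, and too small to contain the
  -- constant `b`.
  let C : Set (M.L0 E) := Metric.closedBall (M.omega 0 fun _ => a) (r / 2)
  let G : ℕ → ℕ → Set (M.HQ E 𝕜) := fun k N =>
    {f | ∃ n ≥ N, {m ∈ {m | M.omega m f.1 ∈ C} | m ≤ n}.ncard * (k + 1) < n + 1}
  have hfin : ∀ (f : M.HQ E 𝕜) n, {m ∈ {m | M.omega m f.1 ∈ C} | m ≤ n}.Finite := fun f n =>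
    (Set.finite_Iic n).subset fun m hm => hm.2
  have hopen : ∀ k N, IsOpen (G k N) := by
    intro k N
    refine isOpen_iff_mem_nhds.2 fun f ⟨n, hn, hlt⟩ => ?_
    -- Near `f` no new visits to `C` occur up to time `n`, so the count cannot grow.
    have hev : ∀ᶠ f' in 𝓝 f, ∀ m ∈ Set.Iic n, M.omega m f.1 ∉ C → M.omega m f'.1 ∉ C := by
      refine ((Set.finite_Iic n).eventually_all).2 fun m _ => ?_
      by_cases hm : M.omega m f.1 ∈ C
      · exact Eventually.of_forall fun _ h => absurd hm h
      · have := ((M.continuous_omega m).comp continuous_subtype_val).continuousAt.eventually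
          (Metric.isClosed_closedBall.isOpen_compl.mem_nhds hm)
        exact this.mono fun _ h _ => h
    filter_upwards [hev] with f' hf'
    refine ⟨n, hn, lt_of_le_of_lt ?_ hlt⟩
    exact Nat.mul_le_mul_right _ (Set.ncard_le_ncard
      (fun m hm => ⟨by_contra fun h => hf' m hm.2 h hm.1, hm.2⟩) (hfin f n))
  have hdense : ∀ k N, Dense (G k N) := by
    refine fun k N => M.dense_of_exists_eq_on_levels fun f₀ L => ?_
    obtain ⟨f, hlow, hlim⟩ := M.exists_tendsto_omega_const f₀ L b
    refine ⟨f, ?_, hlow⟩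
    have hC : (M.omega 0 fun _ => b) ∉ C := fun h => by
      have : r ≤ r / 2 := h
      linarith
    obtain ⟨K, hK⟩ := eventually_atTop.1
      (hlim.eventually (Metric.isClosed_closedBall.isOpen_compl.mem_nhds hC))
    -- All visits to `C` happen before `K`, so there are at most `K` of them.
    refine ⟨max N (K * (k + 1)), le_max_left _ _, Nat.lt_succ_of_le
      (le_trans ?_ (le_max_right _ _))⟩
    gcongr
    refine (Set.ncard_le_ncard (t := (Finset.range K : Set ℕ)) ?_ (Finset.finite_toSet _)).trans
      (by simp)
    intro m hm
    by_contra h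
    exact hK m (by simpa using h) hm.1
  have hres : (⋂ k, ⋂ N, G k N) ∈ residual (M.HQ E 𝕜) :=
    countable_iInter_mem.2 fun k => countable_iInter_mem.2 fun N =>
      residual_of_dense_open (hopen k N) (hdense k N)
  refine mem_of_superset hres fun f hf hU => ?_
  simp only [Set.mem_iInter] at hf
  have h1 := hU (Metric.ball (M.omega 0 fun _ => a) (r / 2)) Metric.isOpen_ball
    ⟨_, Metric.mem_ball_self (by linarith)⟩
  refine h1.not_ge (lowerDensity_nonpos_of_frequently fun k N => ?_)
  obtain ⟨n, hn, hlt⟩ := hf k N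
  refine ⟨n, hn, lt_of_le_of_lt ?_ hlt⟩
  exact Nat.mul_le_mul_right _ (Set.ncard_le_ncard
    (fun m hm => ⟨Metric.ball_subset_closedBall hm.1, hm.2⟩) (hfin f n))

end main

end WeightedTree

end

theorem theorem3p3 {T : Type*} [Countable T] (M : WeightedTree T)
    {𝕜 : Type*} [RCLike 𝕜]
    {E : Type*} [AddCommGroup E] [Module 𝕜 E] [MetricSpace E]
    [IsTopologicalAddGroup E] [ContinuousSMul 𝕜 E] [PolynormableSpace 𝕜 E]
    [CompleteSpace E] [TopologicalSpace.SeparableSpace E] [Nontrivial E]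
    (hdist : ∀ a b c : E, dist (a + c) (b + c) = dist a b) :
    (M.UFM E 𝕜).Nonempty ∧ Dense (M.UFM E 𝕜) ∧ IsMeagre (M.UFM E 𝕜) := by
  have hzero : (0 : T → E) ∈ M.HQ E 𝕜 := fun x => by simp
  obtain ⟨f, hf, -⟩ := M.exists_mem_UFM_eq_on_levels (𝕜 := 𝕜) ⟨0, hzero⟩ 0
  exact ⟨⟨f, hf⟩, M.dense_of_exists_eq_on_levels M.exists_mem_UFM_eq_on_levels, M.isMeagre_UFM⟩
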